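/- Fix $j>0$. For a finite positive Borel measure $\mu$ on $[0,1]$ put $F(r;\mu)=\mu([r,1])$, $r\in[0,1]$; a function $\rho\in L^\infty([0,1],\mathbb R_+)$ is identified with the measure $\rho(r)\,dr$. Let $D_0$ be the Dirac measure at $0$, let $\mathcal U$ be the set of measures $u=c_uD_0+\rho_u(r)\,dr$ with $c_u\ge 0$ and $\rho_u\in L^\infty([0,1],\mathbb R_+)$, and write $u\le v$ iff $F(r;u)\le F(r;v)$ for all $r\in[0,1]$. For $\delta>0$ let $\mathcal U_\delta=\{u\in\mathcal U: F(0;\rho_u)>j\delta\}$ and, for $u\in\mathcal U_\delta$, $$K^{(\delta)}u=j\delta D_0+\mathbf 1_{[0,R_\delta(u)]}u,\qquad R_\delta(u)=\inf\{r\in[0,1]:F(r;u)=j\delta\}.$$ For $t>0$ let $$G^{\rm neum}_t(r,r')=\sum_{k\in\mathbb Z}\big(G_t(r,2k+r')+G_t(r,2k-r')\big),\qquad G_t(r,r')=\frac{e^{-(r-r')^2/(2t)}}{\sqrt{2\pi t}},$$ be the Green function of $\partial_t=\frac12\partial_r^2$ on $[0,1]$ with Neumann boundary conditions, and let $G^{\rm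 neum}_t*u$ be the measure on $[0,1]$ with density $r\mapsto\int G^{\rm neum}_t(r,r')\,u(dr')$. The barriers are defined by $S^{(\delta,\pm)}_0(u)=u$ and, for integers $n\ge1$, $$S^{(\delta,-)}_{n\delta}(u)=K^{(\delta)}\big(G^{\rm neum}_\delta*S^{(\delta,-)}_{(n-1)\delta}(u)\big),\qquad S^{(\delta,+)}_{n\delta}(u)=G^{\rm neum}_\delta*\big(K^{(\delta)}S^{(\delta,+)}_{(n-1)\delta}(u)\big).$$ **Theorem (Macroscopic inequalities).** Let $u\in L^\infty([0,1],\mathbb R_+)$ with $F(0;u)>0$, let $\delta>0$ satisfy $j\delta<F(0;u)$, and let $\delta=k\delta'$ with $k$ a positive integer. Then for every integer $m\ge0$ $$S^{(\delta,-)}_{m\delta}(u)\le S^{(\delta',-)}_{m\delta}(u)\le S^{(\delta',+)}_{m\delta}(u)\le S^{(\delta,+)}_{m\delta}(u).$$ Moreover the following maps preserve the order $\le$: for every $\delta>0$, the map $K^{(\delta)}$ on $\mathcal U_\delta$; for every $t>0$, the map $u\mapsto G^{\rm neum}_t*u$ on $\mathcal U$ (in particular on every $\mathcal U_\delta$); and,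 for every $\delta>0$ and every integer $n\ge0$, the maps $S^{(\delta,\pm)}_{n\delta}$ on $\mathcal U_\delta$. -/

import Mathlib

open MeasureTheory

namespace Barrier

/-- Lebesgue measure `dr` on the interval `[0,1]`. Borel measures on `[0,1]` are represented
by measures on `ℝ` that are carried by `[0,1]`. -/
noncomputable def leb : Measure ℝ := volume.restrict (Set.Icc 0 1)

/-- `ρ ∈ L^∞([0,1], ℝ₊)`: measurable and essentially bounded on `[0,1]`, and nonnegative
almost everywhere there. -/
def IsBddDensity (ρ : ℝ → ℝ) : Prop :=
  MemLp ρ ⊤ leb ∧ 0 ≤ᵐ[leb] ρ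

/-- The measure `ρ(r) dr` on `[0,1]`. -/
noncomputable def densityMeasure (ρ : ℝ → ℝ) : Measure ℝ :=
  leb.withDensity (fun r => ENNReal.ofReal (ρ r))

/-- The tail mass `F(r; μ) = ∫_r^1 μ(dr') = μ([r,1])`. -/
noncomputable def F (r : ℝ) (μ : Measure ℝ) : ENNReal := μ (Set.Icc r 1)

/-- The set `𝒰` of measures `c D₀ + ρ(r) dr` on `[0,1]`, with `c ≥ 0` and
`ρ ∈ L^∞([0,1], ℝ₊)`. -/
def U : Set (Measure ℝ) :=
  {u | ∃ (c : ℝ) (ρ : ℝ → ℝ), 0 ≤ c ∧ IsBddDensity ρ ∧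
    u = ENNReal.ofReal c • Measure.dirac 0 + densityMeasure ρ}

/-- The subset `𝒰_δ` of those `u = c D₀ + ρ dr` in `𝒰` with `F(0; ρ) > j δ`
(the point mass at `0` is not counted). -/
def UDelta (j δ : ℝ) : Set (Measure ℝ) :=
  {u | ∃ (c : ℝ) (ρ : ℝ → ℝ), 0 ≤ c ∧ IsBddDensity ρ ∧
    u = ENNReal.ofReal c • Measure.dirac 0 + densityMeasure ρ ∧
    ENNReal.ofReal (j * δ) < F 0 (densityMeasure ρ)}

/-- The mass-transport order: `u ≤ v` iff `F(r; u) ≤ F(r; v)` for all `r ∈ [0,1]`. -/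
def MassLE (u v : Measure ℝ) : Prop :=
  ∀ r ∈ Set.Icc (0 : ℝ) 1, F r u ≤ F r v

/-- `R_δ(u) = inf {r ∈ [0,1] : F(r; u) = j δ}`. -/
noncomputable def cutPoint (j δ : ℝ) (u : Measure ℝ) : ℝ :=
  sInf {r : ℝ | r ∈ Set.Icc (0 : ℝ) 1 ∧ F r u = ENNReal.ofReal (j * δ)}

/-- The cut-and-paste operator `K^{(δ)} u = j δ D₀ + 1_{[0, R_δ(u)]} u`
(meaningful for `u ∈ 𝒰_δ`). -/
noncomputable def K (j δ : ℝ) (u : Measure ℝ) : Measure ℝ :=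
  ENNReal.ofReal (j * δ) • Measure.dirac 0 + u.restrict (Set.Icc 0 (cutPoint j δ u))

/-- The heat kernel on the line, `G_t(r,r') = exp(-(r-r')²/(2t)) / √(2πt)`. -/
noncomputable def heatKernel (t r r' : ℝ) : ℝ :=
  Real.exp (-(r - r') ^ 2 / (2 * t)) / Real.sqrt (2 * Real.pi * t)

/-- The Green function of `∂_t = ½ ∂_r²` on `[0,1]` with Neumann boundary conditions: the sum of
the heat kernel over the images `2k + r'` and `2k - r'`, `k ∈ ℤ`, of `r'` under repeated
reflections of `[0,1]` at its end points. -/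
noncomputable def neumannKernel (t r r' : ℝ) : ENNReal :=
  ∑' k : ℤ, (ENNReal.ofReal (heatKernel t r (2 * k + r')) +
    ENNReal.ofReal (heatKernel t r (2 * k - r')))

/-- The measure `G_t^neum * u` on `[0,1]`, with density `r ↦ ∫ G_t^neum(r,r') u(dr')`. -/
noncomputable def neumannConv (t : ℝ) (u : Measure ℝ) : Measure ℝ :=
  leb.withDensity (fun r => ∫⁻ r', neumannKernel t r r' ∂u)

/-- The lower barrier after `n` steps, i.e. at time `n δ`:
`S^{(δ,-)}_0(u) = u` and `S^{(δ,-)}_{nδ}(u) = K^{(δ)} (G_δ^neum * S^{(δ,-)}_{(n-1)δ}(u))`. -/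
noncomputable def lowerBarrier (j δ : ℝ) : ℕ → Measure ℝ → Measure ℝ
  | 0, u => u
  | n + 1, u => K j δ (neumannConv δ (lowerBarrier j δ n u))

/-- The upper barrier after `n` steps, i.e. at time `n δ`:
`S^{(δ,+)}_0(u) = u` and `S^{(δ,+)}_{nδ}(u) = G_δ^neum * (K^{(δ)} S^{(δ,+)}_{(n-1)δ}(u))`. -/
noncomputable def upperBarrier (j δ : ℝ) : ℕ → Measure ℝ → Measure ℝ
  | 0, u => u
  | n + 1, u => neumannConv δ (K j δ (upperBarrier j δ n u))

end Barrier

/-!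
The order relations between the barriers follow formally from three properties of the heat flow
`G_t` and the cut `K_δ`: both preserve the order `≤`; cutting after the flow is dominated by
cutting before it, `K_δ G_t ≤ G_t K_δ`, because a cut lowers tails by at most `jδ` and the flow
does not enlarge such a defect; and both are additive in time, `G_s G_t = G_{s+t}` and
`K_δ K_s = K_{s+δ}`. Thus `K_{s+δ} G_{s+δ} = K_δ K_s G_δ G_s ≤ K_δ G_δ K_s G_s`, and dually for
the upper barrier.

The analytic input is that `G_t` preserves `≤`. By the method of images, `G_t * u` is the image of
the Gaussian convolution of `u` under the folding map `ℝ → [0,1]`. Convolution with the uniform law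
on an interval `[-a,a]`, `a ≤ 1`, keeps a function monotone in the distance to `2ℤ`, and the central
limit theorem transfers this property to the Gaussian law.
-/

namespace Barrier

open ProbabilityTheory Filter Topology
open scoped NNReal ENNReal

/-! ### Folding the line onto `[0,1]` -/

/-- The image of `y` under the folding of the line onto `[0,1]` by reflections at the integers,
i.e. the distance from `y` to `2ℤ`. -/
noncomputable def fold (y : ℝ) : ℝ := ‖(y : AddCircle (2 : ℝ))‖

lemma continuous_fold : Continuous fold :=
  continuous_norm.comp (AddCircle.continuous_mk' 2)

lemma fold_mem_Icc (y : ℝ) : fold y ∈ Set.Icc (0 : ℝ) 1 :=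
  ⟨norm_nonneg _, by simpa [fold] using
    AddCircle.norm_le_half_period (2 : ℝ) (x := (y : AddCircle (2 : ℝ))) two_ne_zero⟩

lemma fold_eq_abs {y : ℝ} (hy : |y| ≤ 1) : fold y = |y| :=
  (AddCircle.norm_coe_eq_abs_iff 2 two_ne_zero).2 (by simpa using hy)

lemma fold_of_mem_Icc {y : ℝ} (hy : y ∈ Set.Icc (0 : ℝ) 1) : fold y = y := by
  rw [fold_eq_abs (abs_le.2 ⟨by linarith [hy.1], hy.2⟩), abs_of_nonneg hy.1]

lemma fold_neg (y : ℝ) : fold (-y) = fold y := by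
  rw [fold, AddCircle.coe_neg, norm_neg, fold]

lemma periodic_fold : Function.Periodic fold 2 := fun y => by
  rw [fold, AddCircle.coe_add_period, fold]

lemma fold_add_two_mul (y : ℝ) (k : ℤ) : fold (y + 2 * k) = fold y := by
  rw [mul_comm]; exact periodic_fold.int_mul k y

lemma exists_eq_fold_add (y : ℝ) : ∃ k : ℤ, y = fold y + 2 * k ∨ y = -fold y + 2 * k := by
  refine ⟨round ((2 : ℝ)⁻¹ * y), ?_⟩
  rw [fold, AddCircle.norm_eq]
  rcases abs_choice (y - round ((2 : ℝ)⁻¹ * y) * 2) with h | h <;> rw [h]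
  · left; ring
  · right; ring

lemma countable_fold_fiber (r : ℝ) : {y | fold y = r}.Countable := by
  refine ((Set.countable_range fun k : ℤ => r + 2 * (k : ℝ)).union
    (Set.countable_range fun k : ℤ => -r + 2 * (k : ℝ))).mono ?_
  rintro y rfl
  obtain ⟨k, h | h⟩ := exists_eq_fold_add y
  exacts [Or.inl ⟨k, h.symm⟩, Or.inr ⟨k, h.symm⟩]

lemma fold_sub_le_fold_add {s a : ℝ} (hs : s ∈ Set.Icc (0 : ℝ) 1) (ha : a ∈ Set.Icc (0 : ℝ) 1) :
    fold (s - a) ≤ fold (s + a) := by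
  obtain ⟨hs0, hs1⟩ := hs
  obtain ⟨ha0, ha1⟩ := ha
  have hsub : fold (s - a) = |s - a| := fold_eq_abs (abs_le.2 ⟨by linarith, by linarith⟩)
  rw [hsub]
  rcases le_total (s + a) 1 with h | h
  · rw [fold_of_mem_Icc ⟨by linarith, h⟩]
    exact abs_le.2 ⟨by linarith, by linarith⟩
  · have hrefl : fold (s + a) = 2 - (s + a) := by
      rw [← fold_neg, ← periodic_fold, fold_of_mem_Icc ⟨by linarith, by linarith⟩]
      ring
    rw [hrefl]
    exact abs_le.2 ⟨by linarith, by linarith⟩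

/-- A function is fold-monotone if it depends only on the folding of its argument, in a monotone
way; these are the even `2`-periodic functions that are monotone on `[0,1]`. -/
def FoldMono (h : ℝ → ℝ) : Prop := ∀ ⦃x y⦄, fold x ≤ fold y → h x ≤ h y

namespace FoldMono

variable {h : ℝ → ℝ}

lemma congr_fold (hh : FoldMono h) {x y : ℝ} (hxy : fold x = fold y) : h x = h y :=
  le_antisymm (hh hxy.le) (hh hxy.ge)

lemma apply_fold (hh : FoldMono h) (x : ℝ) : h (fold x) = h x :=
  hh.congr_fold (fold_of_mem_Icc (fold_mem_Icc x))

lemma of_even_of_periodic (heven : h.Even) (hper : Function.Periodic h 2)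
    (hmono : MonotoneOn h (Set.Icc 0 1)) : FoldMono h := by
  have apply_fold (x : ℝ) : h (fold x) = h x := by
    obtain ⟨k, hx | hx⟩ := exists_eq_fold_add x
    · conv_rhs => rw [hx, mul_comm]
      exact (hper.int_mul k _).symm
    · conv_rhs => rw [hx, mul_comm]
      rw [← heven]
      exact (hper.int_mul k _).symm
  intro x y hxy
  rw [← apply_fold x, ← apply_fold y]
  exact hmono (fold_mem_Icc x) (fold_mem_Icc y) hxy

lemma monotoneOn (hh : FoldMono h) : MonotoneOn h (Set.Icc 0 1) := fun x hx y hy hxy =>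
  hh (by rwa [fold_of_mem_Icc hx, fold_of_mem_Icc hy])

lemma measurable (hh : FoldMono h) : Measurable h := by
  have hmono : Monotone fun y : ℝ => h (max 0 (min y 1)) := fun x y hxy =>
    hh.monotoneOn (by simp) (by simp) (by gcongr)
  have hcomp : h = (fun y => h (max 0 (min y 1))) ∘ fold := by
    ext x
    rw [Function.comp_apply, min_eq_left (fold_mem_Icc x).2, max_eq_right (fold_mem_Icc x).1,
      hh.apply_fold]
  rw [hcomp]
  exact hmono.measurable.comp continuous_fold.measurable

lemma mem_Icc (hh : FoldMono h) (x : ℝ) : h x ∈ Set.Icc (h 0) (h 1) := by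
  have h0 : fold 0 = 0 := fold_of_mem_Icc ⟨le_rfl, zero_le_one⟩
  have h1 : fold 1 = 1 := fold_of_mem_Icc ⟨zero_le_one, le_rfl⟩
  exact ⟨hh (h0.trans_le (fold_mem_Icc x).1), hh ((fold_mem_Icc x).2.trans_eq h1.symm)⟩

lemma integrable_comp (hh : FoldMono h) {α : Type*} [MeasurableSpace α] {μ : Measure α}
    [IsFiniteMeasure μ] {g : α → ℝ} (hg : Measurable g) : Integrable (fun z => h (g z)) μ :=
  .of_mem_Icc _ _ (hh.measurable.comp hg).aemeasurable (.of_forall fun z => hh.mem_Icc (g z))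

end FoldMono

/-- Averaging over translates by `μ` keeps fold-monotone functions fold-monotone. This is the
function-side form of the statement that convolution with `μ`, folded onto `[0,1]`, preserves the
mass-transport order. -/
def PreservesFoldMono (μ : Measure ℝ) : Prop :=
  ∀ ⦃h : ℝ → ℝ⦄, FoldMono h → FoldMono fun x => ∫ z, h (x + z) ∂μ

lemma preservesFoldMono_dirac_zero : PreservesFoldMono (Measure.dirac 0) := fun h hh => by
  simpa using hh

lemma PreservesFoldMono.conv {μ ν : Measure ℝ} [IsFiniteMeasure μ] [IsFiniteMeasure ν]
    (hμ : PreservesFoldMono μ) (hν : PreservesFoldMono ν) : PreservesFoldMono (μ ∗ ν) :=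
  fun h hh => by
    have hconv (x : ℝ) : ∫ z, h (x + z) ∂(μ ∗ ν) = ∫ y, ∫ z, h (x + y + z) ∂ν ∂μ := by
      rw [integral_conv (hh.integrable_comp (measurable_const_add x))]
      simp only [add_assoc]
    simp only [hconv]
    exact hμ (hν hh)

/-! ### From uniform to Gaussian convolutions -/

/-- The uniform law on `[-1,1]`. -/
noncomputable def uniformSymm : Measure ℝ := cond volume (Set.Icc (-1) 1)

instance : IsProbabilityMeasure uniformSymm :=
  cond_isProbabilityMeasure_of_finite (by simp) (by simp)

instance (a : ℝ) : IsProbabilityMeasure (uniformSymm.map (a * ·)) :=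
  Measure.isProbabilityMeasure_map (by fun_prop)

lemma integral_uniformSymm (f : ℝ → ℝ) :
    ∫ z, f z ∂uniformSymm = 2⁻¹ * ∫ z in (-1)..1, f z := by
  rw [uniformSymm, ProbabilityTheory.cond, integral_smul_measure, integral_Icc_eq_integral_Ioc,
    intervalIntegral.integral_of_le (by norm_num)]
  norm_num

lemma integral_uniformSymm_scaled {h : ℝ → ℝ} (hh : Measurable h) {a : ℝ} (ha : a ≠ 0) (x : ℝ) :
    ∫ z, h (x + z) ∂uniformSymm.map (a * ·) = (2 * a)⁻¹ * ∫ s in (x - a)..(x + a), h s := by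
  have hmeas : Measurable fun z => h (x + z) := hh.comp (measurable_const_add x)
  rw [integral_map (by fun_prop) hmeas.aestronglyMeasurable, integral_uniformSymm,
    intervalIntegral.integral_comp_add_mul h ha]
  simp only [smul_eq_mul, mul_neg, mul_one, mul_inv, mul_assoc, sub_eq_add_neg]

lemma FoldMono.intervalIntegrable {h : ℝ → ℝ} (hh : FoldMono h) (a b : ℝ) :
    IntervalIntegrable h volume a b :=
  ⟨hh.integrable_comp measurable_id, hh.integrable_comp measurable_id⟩

lemma preservesFoldMono_uniform {a : ℝ} (ha : 0 < a) (ha1 : a ≤ 1) :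
    PreservesFoldMono (uniformSymm.map (a * ·)) := fun h hh => by
  simp only [integral_uniformSymm_scaled hh.measurable ha.ne']
  refine .of_even_of_periodic (fun x => ?_) (fun x => ?_) fun x hx y hy hxy => ?_
  · have heven (s : ℝ) : h (-s) = h s := hh.congr_fold (fold_neg s)
    rw [← intervalIntegral.integral_congr fun s _ => heven s,
      intervalIntegral.integral_comp_neg]
    ring_nf
  · have hper (s : ℝ) : h (s + 2) = h s := hh.congr_fold (periodic_fold s)
    rw [← intervalIntegral.integral_congr (a := x - a) fun s _ => hper s,
      intervalIntegral.integral_comp_add_right]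
    ring_nf
  · have hflux : (∫ s in (y - a)..(y + a), h s) - ∫ s in (x - a)..(x + a), h s =
        ∫ s in x..y, (h (s + a) - h (s - a)) := by
      rw [intervalIntegral.integral_sub, intervalIntegral.integral_comp_add_right,
        intervalIntegral.integral_comp_sub_right,
        intervalIntegral.integral_interval_sub_interval_comm'] <;>
      first
      | exact hh.intervalIntegrable _ _
      | exact ⟨hh.integrable_comp (by fun_prop), hh.integrable_comp (by fun_prop)⟩
    have hflux_nonneg : 0 ≤ ∫ s in x..y, (h (s + a) - h (s - a)) :=
      intervalIntegral.integral_nonneg hxy fun s hs => sub_nonneg.2 <|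
        hh (fold_sub_le_fold_add ⟨hx.1.trans hs.1, hs.2.trans hy.2⟩ ⟨ha.le, ha1⟩)
    gcongr
    linarith

/-- The `n`-th convolution power of a measure on `ℝ`. -/
noncomputable def convPow (μ : Measure ℝ) : ℕ → Measure ℝ
  | 0 => Measure.dirac 0
  | n + 1 => convPow μ n ∗ μ

section convPow

variable {μ : Measure ℝ} [IsProbabilityMeasure μ]

instance (n : ℕ) : IsProbabilityMeasure (convPow μ n) := by
  induction n with
  | zero => rw [convPow]; infer_instance
  | succ n ih => rw [convPow]; infer_instance

lemma charFun_convPow (n : ℕ) (s : ℝ) : charFun (convPow μ n) s = charFun μ s ^ n := by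
  induction n with
  | zero => simp [convPow]
  | succ n ih => rw [convPow, charFun_conv, ih, pow_succ]

lemma PreservesFoldMono.convPow (hμ : PreservesFoldMono μ) (n : ℕ) :
    PreservesFoldMono (convPow μ n) := by
  induction n with
  | zero => exact preservesFoldMono_dirac_zero
  | succ n ih => exact ih.conv hμ

end convPow

lemma tendsto_charFun_convPow_uniformSymm (t : ℝ≥0) (s : ℝ) :
    Tendsto (fun n : ℕ => charFun (convPow (uniformSymm.map ((√n)⁻¹ * √(3 * t) * ·)) n) s)
      atTop (𝓝 (charFun (gaussianReal 0 t) s)) := by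
  have hmean : ∫ z, √3 * z ∂uniformSymm = 0 := by
    rw [integral_uniformSymm, intervalIntegral.integral_const_mul, integral_id]; norm_num
  have hvar : ∫ z, (√3 * z) ^ 2 ∂uniformSymm = 1 := by
    rw [integral_uniformSymm]
    simp only [mul_pow, intervalIntegral.integral_const_mul, integral_pow]
    norm_num
  have hclt := tendsto_charFun_inv_sqrt_mul_pow (P := uniformSymm) (X := fun z => √3 * z)
    (by fun_prop) hmean hvar (√t * s)
  have hgauss : charFun (gaussianReal 0 t) s = Complex.exp (-(√t * s : ℝ) ^ 2 / 2) := by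
    rw [charFun_gaussianReal]
    norm_cast
    simp [mul_pow, neg_div]
  rw [hgauss]
  refine hclt.congr fun n => ?_
  rw [charFun_convPow, charFun_map_mul, charFun_map_mul, Real.sqrt_mul zero_le_three]
  ring_nf

lemma exists_preservesFoldMono_tendsto_gaussianReal {t : ℝ≥0} (ht : t ≠ 0) :
    ∃ ν : ℕ → ProbabilityMeasure ℝ, (∀ᶠ n in atTop, PreservesFoldMono (ν n)) ∧
      Tendsto ν atTop (𝓝 ⟨gaussianReal 0 t, inferInstance⟩) := by
  refine ⟨fun n => ⟨convPow (uniformSymm.map ((√n)⁻¹ * √(3 * t) * ·)) n, inferInstance⟩, ?_,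
    ProbabilityMeasure.tendsto_of_tendsto_charFun (tendsto_charFun_convPow_uniformSymm t)⟩
  have hscale : Tendsto (fun n : ℕ => (√n)⁻¹ * √(3 * t)) atTop (𝓝 0) := by
    simpa using ((Real.tendsto_sqrt_atTop.comp
      tendsto_natCast_atTop_atTop).inv_tendsto_atTop).mul_const √(3 * t)
  filter_upwards [hscale.eventually_le_const zero_lt_one, eventually_gt_atTop 0] with n hle hn
  exact (preservesFoldMono_uniform (by positivity) hle).convPow n

lemma foldMono_indicator_tail (r : ℝ) : FoldMono (Set.indicator {y | r ≤ fold y} 1) :=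
  fun _ _ hxy => Set.indicator_apply_le' (fun hx => (Set.indicator_of_mem (hx.trans hxy) 1).ge)
    fun _ => Set.indicator_apply_nonneg fun _ => zero_le_one

lemma integral_indicator_tail (μ : Measure ℝ) (r x : ℝ) :
    ∫ z, Set.indicator {y | r ≤ fold y} 1 (x + z) ∂μ = μ.real {z | r ≤ fold (x + z)} :=
  integral_indicator_one (s := {z | r ≤ fold (x + z)})
    (measurableSet_le measurable_const (continuous_fold.measurable.comp (measurable_const_add x)))

lemma foldMono_tail_of_tendsto {ν : ℕ → ProbabilityMeasure ℝ} {γ : ProbabilityMeasure ℝ}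
    (hγ : NullSingletonClass (γ : Measure ℝ)) (hν : ∀ᶠ n in atTop, PreservesFoldMono (ν n))
    (hlim : Tendsto ν atTop (𝓝 γ)) (r : ℝ) :
    FoldMono fun x => (γ : Measure ℝ).real {z | r ≤ fold (x + z)} := by
  have hfrontier (x : ℝ) : (γ : Measure ℝ) (frontier {z | r ≤ fold (x + z)}) = 0 := by
    refine Set.Countable.measure_zero (Set.Countable.mono (frontier_le_subset_eq
      continuous_const (continuous_fold.comp (continuous_const_add x))) ?_) _
    simp only [eq_comm (a := r)]
    exact (countable_fold_fiber r).preimage (add_right_injective x)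
  have htail (x : ℝ) : Tendsto (fun n => (ν n : Measure ℝ).real {z | r ≤ fold (x + z)}) atTop
      (𝓝 ((γ : Measure ℝ).real {z | r ≤ fold (x + z)})) :=
    (ENNReal.tendsto_toReal (measure_ne_top _ _)).comp
      (ProbabilityMeasure.tendsto_measure_of_null_frontier_of_tendsto' hlim (hfrontier x))
  intro x y hxy
  refine le_of_tendsto_of_tendsto (htail x) (htail y) (hν.mono fun n hn => ?_)
  simpa only [integral_indicator_tail] using hn (foldMono_indicator_tail r) hxy

lemma foldMono_gaussianReal_tail {t : ℝ≥0} (ht : t ≠ 0) (r : ℝ) :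
    FoldMono fun x => (gaussianReal 0 t).real {z | r ≤ fold (x + z)} := by
  obtain ⟨ν, hν, hlim⟩ := exists_preservesFoldMono_tendsto_gaussianReal ht
  exact foldMono_tail_of_tendsto (γ := ⟨gaussianReal 0 t, inferInstance⟩)
    (nullSingletonClass_gaussianReal ht) hν hlim r

/-! ### The method of images -/

lemma lintegral_eq_tsum_Ioc {g : ℝ → ℝ≥0∞} (hg : Measurable g) :
    ∫⁻ y, g y = ∑' k : ℤ, ∫⁻ y in Set.Ioc (-1 : ℝ) 1, g (y + 2 * k) := by
  have htranslate (k : ℤ) :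
      ∫⁻ y in Set.Ioc (-1 + k • (2 : ℝ)) (-1 + (k + 1) • (2 : ℝ)), g y =
        ∫⁻ y in Set.Ioc (-1 : ℝ) 1, g (y + 2 * k) := by
    rw [← (measurePreserving_add_right volume (2 * (k : ℝ))).setLIntegral_comp_preimage
      measurableSet_Ioc hg, Set.preimage_add_const_Ioc]
    congr! 3 <;> simp only [zsmul_eq_mul, Int.cast_add, Int.cast_one] <;> ring
  rw [← setLIntegral_univ, ← iUnion_Ioc_add_zsmul zero_lt_two (-1 : ℝ),
    lintegral_iUnion (fun _ => measurableSet_Ioc) (Set.pairwise_disjoint_Ioc_add_zsmul _ _)]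
  exact tsum_congr htranslate

lemma setLIntegral_Ioc_neg_one_one {g : ℝ → ℝ≥0∞} (hg : Measurable g) :
    ∫⁻ y in Set.Ioc (-1 : ℝ) 1, g y = ∫⁻ y, (g y + g (-y)) ∂leb := by
  have hreflect : ∫⁻ y in Set.Ioc (-1 : ℝ) 0, g y = ∫⁻ y in Set.Icc (0 : ℝ) 1, g (-y) := by
    rw [restrict_Ioc_eq_restrict_Icc,
      ← (Measure.measurePreserving_neg (volume : Measure ℝ)).setLIntegral_comp_preimage
        measurableSet_Icc hg]
    simp
  rw [← Set.Ioc_union_Ioc_eq_Ioc neg_one_lt_zero.le zero_le_one,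
    lintegral_union measurableSet_Ioc (Set.Ioc_disjoint_Ioc_of_le le_rfl), hreflect,
    restrict_Ioc_eq_restrict_Icc, add_comm, leb, lintegral_add_left hg]

lemma lintegral_eq_lintegral_leb_tsum {g : ℝ → ℝ≥0∞} (hg : Measurable g) :
    ∫⁻ y, g y = ∫⁻ y, ∑' k : ℤ, (g (y + 2 * k) + g (-y + 2 * k)) ∂leb := by
  rw [lintegral_eq_tsum_Ioc hg, lintegral_tsum fun k => by fun_prop]
  exact tsum_congr fun k => setLIntegral_Ioc_neg_one_one (hg.comp (measurable_add_const _))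

lemma heatKernel_eq_of_sq_eq {t a b c d : ℝ} (h : (a - b) ^ 2 = (c - d) ^ 2) :
    heatKernel t a b = heatKernel t c d := by
  rw [heatKernel, heatKernel, h]

lemma neumannKernel_eq_tsum (t r x : ℝ) :
    neumannKernel t r x = ∑' k : ℤ, (ENNReal.ofReal (heatKernel t (r + 2 * k) x) +
      ENNReal.ofReal (heatKernel t (-r + 2 * k) x)) := by
  rw [neumannKernel, ENNReal.tsum_add, ENNReal.tsum_add, ← (Equiv.neg ℤ).tsum_eq]
  congr 1 <;> refine tsum_congr fun k => congrArg _ (heatKernel_eq_of_sq_eq ?_)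
  · rw [Equiv.neg_apply]; push_cast; ring
  · ring

lemma gaussianPDF_eq_heatKernel {t : ℝ} (ht : 0 ≤ t) (x y : ℝ) :
    gaussianPDF x t.toNNReal y = ENNReal.ofReal (heatKernel t y x) := by
  rw [gaussianPDF, gaussianPDFReal_def, heatKernel, Real.coe_toNNReal t ht, div_eq_inv_mul]

lemma lintegral_neumannKernel_mul {t : ℝ} (ht : 0 < t) {f : ℝ → ℝ≥0∞} (hf : Measurable f) (x : ℝ) :
    ∫⁻ r, neumannKernel t r x * f r ∂leb = ∫⁻ y, f (fold y) ∂gaussianReal x t.toNNReal := by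
  have hfold : Measurable fun y => f (fold y) := hf.comp continuous_fold.measurable
  rw [gaussianReal_of_var_ne_zero _ (by simpa using ht),
    lintegral_withDensity_eq_lintegral_mul _ (measurable_gaussianPDF _ _) hfold,
    lintegral_eq_lintegral_leb_tsum ((measurable_gaussianPDF _ _).mul hfold)]
  refine setLIntegral_congr_fun measurableSet_Icc fun r hr => ?_
  simp only [Pi.mul_apply, fold_add_two_mul, fold_neg, fold_of_mem_Icc hr,
    gaussianPDF_eq_heatKernel ht.le, neumannKernel_eq_tsum, ← add_mul, ENNReal.tsum_mul_right]

lemma measurable_neumannKernel (t : ℝ) : Measurable fun p : ℝ × ℝ => neumannKernel t p.1 p.2 := by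
  unfold neumannKernel heatKernel
  fun_prop

lemma lintegral_neumannConv {t : ℝ} (ht : 0 < t) (u : Measure ℝ) [SFinite u] {f : ℝ → ℝ≥0∞}
    (hf : Measurable f) :
    ∫⁻ r, f r ∂neumannConv t u = ∫⁻ x, ∫⁻ y, f (fold y) ∂gaussianReal x t.toNNReal ∂u := by
  have : SFinite leb := inferInstanceAs (SFinite (volume.restrict _))
  have hker := measurable_neumannKernel t
  calc ∫⁻ r, f r ∂neumannConv t u
      = ∫⁻ r, (∫⁻ x, neumannKernel t r x ∂u) * f r ∂leb :=
        lintegral_withDensity_eq_lintegral_mul _ hker.lintegral_prod_right' hf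
    _ = ∫⁻ r, ∫⁻ x, neumannKernel t r x * f r ∂u ∂leb :=
        lintegral_congr fun r =>
          (lintegral_mul_const _ (hker.comp measurable_prodMk_left)).symm
    _ = ∫⁻ x, ∫⁻ r, neumannKernel t r x * f r ∂leb ∂u :=
        lintegral_lintegral_swap (hker.mul (hf.comp measurable_fst)).aemeasurable
    _ = ∫⁻ x, ∫⁻ y, f (fold y) ∂gaussianReal x t.toNNReal ∂u :=
        lintegral_congr fun x => lintegral_neumannKernel_mul ht hf x

theorem neumannConv_eq_map_fold {t : ℝ} (ht : 0 < t) (u : Measure ℝ) [SFinite u] :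
    neumannConv t u = (u ∗ gaussianReal 0 t.toNNReal).map fold := by
  refine Measure.ext_of_lintegral _ fun f hf => ?_
  have hfold : Measurable fun y => f (fold y) := hf.comp continuous_fold.measurable
  rw [lintegral_neumannConv ht u hf, lintegral_map hf continuous_fold.measurable,
    Measure.lintegral_conv hfold]
  refine lintegral_congr fun x => ?_
  rw [← lintegral_map hfold (measurable_const_add x), gaussianReal_map_const_add, zero_add]

instance (t : ℝ≥0) : Measure.IsNegInvariant (gaussianReal 0 t) where
  neg_eq_self := gaussianReal_map_neg.trans (by rw [neg_zero])

lemma lintegral_fold_fold_add (γ : Measure ℝ) [γ.IsNegInvariant] (f : ℝ → ℝ≥0∞) (y : ℝ) :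
    ∫⁻ z, f (fold (fold y + z)) ∂γ = ∫⁻ z, f (fold (y + z)) ∂γ := by
  obtain ⟨k, hk | hk⟩ := exists_eq_fold_add y
  · refine lintegral_congr fun z => congrArg f ?_
    conv_rhs => rw [hk, add_right_comm, fold_add_two_mul]
  · rw [← lintegral_neg_eq_self]
    refine lintegral_congr fun z => congrArg f ?_
    conv_rhs => rw [hk, add_right_comm, fold_add_two_mul, ← fold_neg]
    ring_nf

lemma map_fold_conv_map_fold (μ γ : Measure ℝ) [SFinite γ] [γ.IsNegInvariant] :
    (μ.map fold ∗ γ).map fold = (μ ∗ γ).map fold := by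
  refine Measure.ext_of_lintegral _ fun f hf => ?_
  have hfold := continuous_fold.measurable
  have hinner : Measurable fun y => ∫⁻ z, f (fold (y + z)) ∂γ :=
    (hf.comp (hfold.comp measurable_add)).lintegral_prod_right'
  have hcomp : Measurable fun y => f (fold y) := hf.comp hfold
  rw [lintegral_map hf hfold, lintegral_map hf hfold, Measure.lintegral_conv hcomp,
    Measure.lintegral_conv hcomp, lintegral_map hinner hfold]
  exact lintegral_congr fun y => lintegral_fold_fold_add γ f y

theorem neumannConv_neumannConv {s t : ℝ} (hs : 0 < s) (ht : 0 < t) (u : Measure ℝ) [SFinite u] :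
    neumannConv s (neumannConv t u) = neumannConv (t + s) u := by
  rw [neumannConv_eq_map_fold ht, neumannConv_eq_map_fold hs, map_fold_conv_map_fold,
    neumannConv_eq_map_fold (add_pos ht hs), Measure.conv_assoc, gaussianReal_conv_gaussianReal,
    Real.toNNReal_add ht.le hs.le, add_zero]

lemma isFiniteMeasure_neumannConv {t : ℝ} (ht : 0 < t) (u : Measure ℝ) [IsFiniteMeasure u] :
    IsFiniteMeasure (neumannConv t u) := by
  rw [neumannConv_eq_map_fold ht]; infer_instance

/-! ### Tails under the heat flow -/

/-- The probability that Brownian motion reflected at the end points of `[0,1]` and started at `x`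
lies in `[r,1]` at time `t`. -/
noncomputable def heatTail (t r x : ℝ) : ℝ :=
  (gaussianReal 0 t.toNNReal).real {z | r ≤ fold (x + z)}

lemma foldMono_heatTail {t : ℝ} (ht : 0 < t) (r : ℝ) : FoldMono (heatTail t r) :=
  foldMono_gaussianReal_tail (by simpa using ht) r

lemma F_neumannConv {t : ℝ} (ht : 0 < t) (u : Measure ℝ) [SFinite u] (r : ℝ) :
    F r (neumannConv t u) = ∫⁻ x, ENNReal.ofReal (heatTail t r x) ∂u := by
  have hIcc : fold ⁻¹' Set.Icc r 1 = {y | r ≤ fold y} :=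
    Set.ext fun y => and_iff_left (fold_mem_Icc y).2
  have hmeas : MeasurableSet {y | r ≤ fold y} :=
    measurableSet_le measurable_const continuous_fold.measurable
  rw [F, neumannConv_eq_map_fold ht, Measure.map_apply continuous_fold.measurable measurableSet_Icc,
    hIcc, ← lintegral_indicator_one hmeas, Measure.lintegral_conv (measurable_one.indicator hmeas)]
  refine lintegral_congr fun x => ?_
  rw [heatTail, ofReal_measureReal]
  exact lintegral_indicator_one (s := {z | r ≤ fold (x + z)})
    (hmeas.preimage (measurable_const_add x))

lemma F_zero_eq_univ {u : Measure ℝ} (hu : ∀ᵐ x ∂u, x ∈ Set.Icc (0 : ℝ) 1) :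
    F 0 u = u Set.univ :=
  measure_eq_measure_of_null_sdiff (Set.subset_univ _)
    (by rw [← Set.compl_eq_univ_sdiff]; exact mem_ae_iff.1 hu)

lemma F_zero_neumannConv {t : ℝ} (ht : 0 < t) {u : Measure ℝ} [SFinite u]
    (hu : ∀ᵐ x ∂u, x ∈ Set.Icc (0 : ℝ) 1) : F 0 (neumannConv t u) = F 0 u := by
  have hone (x : ℝ) : heatTail t 0 x = 1 := by
    simp [heatTail, (fold_mem_Icc _).1]
  simp [F_neumannConv ht, hone, F_zero_eq_univ hu]

lemma measure_upperSet_le_of_massLE {u v : Measure ℝ} (huv : MassLE u v) {A : Set ℝ}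
    (hA : A ⊆ Set.Icc 0 1) (hup : ∀ x ∈ A, Set.Icc x 1 ⊆ A) : u A ≤ v A := by
  rcases A.eq_empty_or_nonempty with rfl | hne
  · simp
  have hbdd : BddBelow A := bddBelow_Icc.mono hA
  obtain ⟨a, ha_anti, ha_lim, ha_mem⟩ := exists_seq_tendsto_sInf hne hbdd
  by_cases hmin : sInf A ∈ A
  · have hAeq : A = Set.Icc (sInf A) 1 :=
      Set.Subset.antisymm (fun x hx => ⟨csInf_le hbdd hx, (hA hx).2⟩) (hup _ hmin)
    rw [hAeq]
    exact huv _ (hA hmin)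
  · have hAeq : A = ⋃ n, Set.Icc (a n) 1 := by
      refine Set.Subset.antisymm (fun x hx => ?_) (Set.iUnion_subset fun n => hup _ (ha_mem n))
      have hlt : sInf A < x := (csInf_le hbdd hx).lt_of_ne fun h => hmin (h ▸ hx)
      obtain ⟨n, hn⟩ := (ha_lim.eventually_lt_const hlt).exists
      exact Set.mem_iUnion.2 ⟨n, hn.le, (hA hx).2⟩
    have hmono : Monotone fun n => Set.Icc (a n) 1 := fun m n hmn =>
      Set.Icc_subset_Icc_left (ha_anti hmn)
    rw [hAeq, hmono.measure_iUnion, hmono.measure_iUnion]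
    exact iSup_mono fun n => huv _ (hA (ha_mem n))

lemma lintegral_le_of_massLE {u v : Measure ℝ} (hu : ∀ᵐ x ∂u, x ∈ Set.Icc (0 : ℝ) 1)
    (huv : MassLE u v) {f : ℝ → ℝ} (hf : Measurable f) (hf0 : 0 ≤ f)
    (hmono : MonotoneOn f (Set.Icc 0 1)) :
    ∫⁻ x, ENNReal.ofReal (f x) ∂u ≤ ∫⁻ x, ENNReal.ofReal (f x) ∂v := by
  rw [lintegral_eq_lintegral_meas_le u (.of_forall hf0) hf.aemeasurable,
    lintegral_eq_lintegral_meas_le v (.of_forall hf0) hf.aemeasurable]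
  refine lintegral_mono fun c => ?_
  calc u {x | c ≤ f x} = u ({x | c ≤ f x} ∩ Set.Icc 0 1) := by
        rw [Set.inter_comm, Measure.measure_inter_eq_of_ae hu]
    _ ≤ v ({x | c ≤ f x} ∩ Set.Icc 0 1) :=
        measure_upperSet_le_of_massLE huv Set.inter_subset_right fun x hx y hy =>
          have hy' : y ∈ Set.Icc (0 : ℝ) 1 := ⟨hx.2.1.trans hy.1, hy.2⟩
          ⟨hx.1.trans (hmono hx.2 hy' hy.1), hy'⟩
    _ ≤ v {x | c ≤ f x} := measure_mono Set.inter_subset_left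

theorem MassLE.neumannConv {t : ℝ} (ht : 0 < t) {u v : Measure ℝ} [SFinite u] [SFinite v]
    (hu : ∀ᵐ x ∂u, x ∈ Set.Icc (0 : ℝ) 1) (huv : MassLE u v) :
    MassLE (neumannConv t u) (neumannConv t v) := fun r _ => by
  rw [F_neumannConv ht, F_neumannConv ht]
  exact lintegral_le_of_massLE hu huv (foldMono_heatTail ht r).measurable
    (fun _ => measureReal_nonneg) (foldMono_heatTail ht r).monotoneOn

/-- A defect `b` in the tail comparison is absorbed by a point mass `b` at `1`, whose image under
the heat flow contributes at most `b` to every tail. -/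
lemma F_neumannConv_le_add {t : ℝ} (ht : 0 < t) {u v : Measure ℝ} [SFinite u] [SFinite v]
    (hu : ∀ᵐ x ∂u, x ∈ Set.Icc (0 : ℝ) 1) {b : ℝ≥0∞}
    (huv : ∀ r ∈ Set.Icc (0 : ℝ) 1, F r u ≤ F r v + b) {r : ℝ} (hr : r ∈ Set.Icc (0 : ℝ) 1) :
    F r (neumannConv t u) ≤ F r (neumannConv t v) + b := by
  have hle : MassLE u (v + b • Measure.dirac 1) := fun s hs =>
    (huv s hs).trans_eq (by simp [F, hs.2])
  refine (hle.neumannConv ht hu r hr).trans ?_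
  rw [F_neumannConv ht, F_neumannConv ht, lintegral_add_measure, lintegral_smul_measure,
    lintegral_dirac]
  gcongr
  refine mul_le_of_le_one_right' ?_
  exact ENNReal.ofReal_le_one.2 measureReal_le_one

/-! ### The cut -/

lemma F_antitone (u : Measure ℝ) : Antitone fun r => F r u :=
  fun _ _ h => measure_mono (Set.Icc_subset_Icc_left h)

lemma measure_Ioc_le_F_zero (u : Measure ℝ) : u (Set.Ioc 0 1) ≤ F 0 u :=
  measure_mono Set.Ioc_subset_Icc_self

/-- Finite measures on `[0,1]` with no atoms except possibly at `0`: a class containing `𝒰` on which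
the tail `r ↦ F r u` is continuous away from `0`, so that cut points behave as expected. -/
structure Admissible (u : Measure ℝ) : Prop where
  finite : IsFiniteMeasure u
  ae_mem : ∀ᵐ x ∂u, x ∈ Set.Icc (0 : ℝ) 1
  measure_singleton : ∀ x, x ≠ 0 → u {x} = 0

/-- The analogue of `𝒰_δ` for admissible measures: the mass off the point `0` exceeds `j δ`, so
that `K^{(δ)}` can remove the mass `j δ` from the right. -/
structure Cuttable (j δ : ℝ) (u : Measure ℝ) : Prop extends Admissible u where
  lt_measure_Ioc : ENNReal.ofReal (j * δ) < u (Set.Ioc 0 1)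

section Cut

variable {u v : Measure ℝ} {j δ r t : ℝ}

lemma Admissible.sFinite (hu : Admissible u) : SFinite u :=
  have := hu.finite
  inferInstance

lemma Admissible.measure_Ioc (hu : Admissible u) (hr : r ≠ 0) : u (Set.Ioc r 1) = F r u := by
  refine measure_eq_measure_of_null_sdiff Set.Ioc_subset_Icc_self
    (measure_mono_null (fun x hx => ?_) (hu.measure_singleton r hr))
  exact (hx.1.1.eq_of_not_lt fun h => hx.2 ⟨h, hx.1.2⟩).symm

lemma Admissible.continuousOn_measureReal_Ioc (hu : Admissible u) :
    ContinuousOn (fun r => u.real (Set.Ioc r 1)) (Set.Icc 0 1) := by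
  have := hu.finite
  set μ := u.restrict (Set.Ioi 0) with hμ
  have : NullSingletonClass μ := ⟨fun x => by
    rw [hμ, Measure.restrict_apply (measurableSet_singleton x)]
    by_cases hx : x = 0
    · simp [hx]
    · exact measure_mono_null Set.inter_subset_left (hu.measure_singleton x hx)⟩
  have hprim : Continuous fun b : ℝ => ∫ _ in (1 : ℝ)..b, (1 : ℝ) ∂μ :=
    intervalIntegral.continuous_primitive (fun a b => intervalIntegrable_const) 1
  refine hprim.neg.continuousOn.congr fun r hr => ?_
  have hsub : Set.Ioc r 1 ∩ Set.Ioi 0 = Set.Ioc r 1 :=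
    Set.inter_eq_left.2 fun x hx => hr.1.trans_lt hx.1
  rw [Pi.neg_apply, ← intervalIntegral.integral_symm, intervalIntegral.integral_of_le hr.2]
  simp [hμ, measureReal_def, hsub]

namespace Cuttable

lemma lt_F_zero (hu : Cuttable j δ u) : ENNReal.ofReal (j * δ) < F 0 u :=
  hu.lt_measure_Ioc.trans_le (measure_Ioc_le_F_zero u)

lemma F_eq_iff (hu : Cuttable j δ u) (r : ℝ) :
    F r u = ENNReal.ofReal (j * δ) ↔
      u.real (Set.Ioc r 1) = (ENNReal.ofReal (j * δ)).toReal := by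
  have := hu.finite
  rw [measureReal_def, ENNReal.toReal_eq_toReal_iff' (measure_ne_top u _) ENNReal.ofReal_ne_top]
  by_cases h0 : r = 0
  · subst h0
    exact iff_of_false hu.lt_F_zero.ne' hu.lt_measure_Ioc.ne'
  · rw [hu.measure_Ioc h0]

lemma cutPoint_mem (hu : Cuttable j δ u) :
    cutPoint j δ u ∈ {r | r ∈ Set.Icc (0 : ℝ) 1 ∧ F r u = ENNReal.ofReal (j * δ)} := by
  have := hu.finite
  have hlevel : {r | r ∈ Set.Icc (0 : ℝ) 1 ∧ F r u = ENNReal.ofReal (j * δ)} =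
      Set.Icc 0 1 ∩ (fun r => u.real (Set.Ioc r 1)) ⁻¹' {(ENNReal.ofReal (j * δ)).toReal} :=
    Set.ext fun r => and_congr_right fun _ => hu.F_eq_iff r
  have hcont := hu.continuousOn_measureReal_Ioc
  rw [cutPoint, hlevel]
  refine (hcont.preimage_isClosed_of_isClosed isClosed_Icc isClosed_singleton).csInf_mem ?_
    (bddBelow_Icc.mono Set.inter_subset_left)
  refine intermediate_value_Icc' zero_le_one hcont ⟨?_, ?_⟩
  · simp
  · exact ENNReal.toReal_mono (measure_ne_top u _) hu.lt_measure_Ioc.le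

lemma F_cutPoint (hu : Cuttable j δ u) : F (cutPoint j δ u) u = ENNReal.ofReal (j * δ) :=
  hu.cutPoint_mem.2

lemma cutPoint_pos (hu : Cuttable j δ u) : 0 < cutPoint j δ u :=
  hu.cutPoint_mem.1.1.lt_of_ne fun h => hu.lt_F_zero.ne (by rw [h, hu.F_cutPoint])

lemma measure_eq_inter_add (hu : Cuttable j δ u) {A : Set ℝ} (hA : A ⊆ Set.Icc 0 1)
    (hcut : Set.Ioc (cutPoint j δ u) 1 ⊆ A) :
    u A = u (A ∩ Set.Icc 0 (cutPoint j δ u)) + ENNReal.ofReal (j * δ) := by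
  have hdiff : A \ Set.Icc 0 (cutPoint j δ u) = Set.Ioc (cutPoint j δ u) 1 :=
    Set.Subset.antisymm
      (fun x hx => ⟨not_le.1 fun hle => hx.2 ⟨(hA hx.1).1, hle⟩, (hA hx.1).2⟩)
      (fun x hx => ⟨hcut hx, fun hx' => hx.1.not_ge hx'.2⟩)
  rw [← measure_inter_add_sdiff A measurableSet_Icc, hdiff, hu.measure_Ioc hu.cutPoint_pos.ne',
    hu.F_cutPoint]

lemma F_K (hu : Cuttable j δ u) (hr : 0 < r) :
    F r (K j δ u) = F r u - ENNReal.ofReal (j * δ) := by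
  have hF : F r (K j δ u) = u (Set.Icc r 1 ∩ Set.Icc 0 (cutPoint j δ u)) := by
    simp [F, K, Measure.restrict_apply measurableSet_Icc, hr]
  rw [hF]
  rcases le_or_gt r (cutPoint j δ u) with hle | hgt
  · rw [F, hu.measure_eq_inter_add (Set.Icc_subset_Icc_left hr.le)
      fun x hx => ⟨hle.trans hx.1.le, hx.2⟩, ENNReal.add_sub_cancel_right ENNReal.ofReal_ne_top]
  · have hdisj : Disjoint (Set.Icc r 1) (Set.Icc 0 (cutPoint j δ u)) :=
      Set.disjoint_left.2 fun x hx hx' => (hgt.trans_le hx.1).not_ge hx'.2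
    rw [tsub_eq_zero_of_le (hu.F_cutPoint ▸ F_antitone u hgt.le), hdisj.inter_eq, measure_empty]

lemma F_zero_K (hu : Cuttable j δ u) : F 0 (K j δ u) = F 0 u := by
  rw [F, F, hu.measure_eq_inter_add subset_rfl
    fun x hx => ⟨hu.cutPoint_pos.le.trans hx.1.le, hx.2⟩]
  simp [K, Measure.restrict_apply measurableSet_Icc, add_comm]

lemma K_Ioc (hu : Cuttable j δ u) :
    K j δ u (Set.Ioc 0 1) = u (Set.Ioc 0 1) - ENNReal.ofReal (j * δ) := by
  rw [hu.measure_eq_inter_add Set.Ioc_subset_Icc_self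
      fun x hx => ⟨hu.cutPoint_pos.trans hx.1, hx.2⟩,
    ENNReal.add_sub_cancel_right ENNReal.ofReal_ne_top]
  simp [K, Measure.restrict_apply measurableSet_Ioc]

lemma F_le_F_K_add (hu : Cuttable j δ u) (hr : 0 ≤ r) :
    F r u ≤ F r (K j δ u) + ENNReal.ofReal (j * δ) := by
  rcases hr.eq_or_lt with rfl | h0
  · exact hu.F_zero_K ▸ le_self_add
  · exact hu.F_K h0 ▸ le_tsub_add

end Cuttable

lemma withDensity_leb_Ioc (f : ℝ → ℝ≥0∞) :
    leb.withDensity f (Set.Ioc 0 1) = F 0 (leb.withDensity f) := by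
  have : NullSingletonClass leb := by unfold leb; infer_instance
  exact measure_congr
    ((withDensity_absolutelyContinuous leb f).ae_le Ioc_ae_eq_Icc)

lemma admissible_withDensity_leb (f : ℝ → ℝ≥0∞) (hf : IsFiniteMeasure (leb.withDensity f)) :
    Admissible (leb.withDensity f) where
  finite := hf
  ae_mem := (withDensity_absolutelyContinuous leb f).ae_le (ae_restrict_mem measurableSet_Icc)
  measure_singleton x _ := withDensity_absolutelyContinuous leb f (by simp [leb])

lemma admissible_smul_dirac_zero (c : ℝ) : Admissible (ENNReal.ofReal c • Measure.dirac 0) where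
  finite := Measure.smul_finite _ ENNReal.ofReal_ne_top
  ae_mem := Measure.ae_smul_measure (by simp) _
  measure_singleton x hx := by simp [hx.symm]

namespace Admissible

protected lemma add (hu : Admissible u) (hv : Admissible v) : Admissible (u + v) where
  finite := by have := hu.finite; have := hv.finite; infer_instance
  ae_mem := ae_add_measure_iff.2 ⟨hu.ae_mem, hv.ae_mem⟩
  measure_singleton x hx := by simp [hu.measure_singleton x hx, hv.measure_singleton x hx]

protected lemma mono (hu : Admissible u) (hvu : v ≤ u) : Admissible v where
  finite := have := hu.finite; isFiniteMeasure_of_le u hvu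
  ae_mem := ae_mono hvu hu.ae_mem
  measure_singleton x hx := nonpos_iff_eq_zero.1 ((hvu _).trans (hu.measure_singleton x hx).le)

protected lemma K (hu : Admissible u) (j δ : ℝ) : Admissible (K j δ u) :=
  (admissible_smul_dirac_zero _).add (hu.mono Measure.restrict_le_self)

protected lemma neumannConv (hu : Admissible u) (ht : 0 < t) : Admissible (neumannConv t u) :=
  have := hu.finite
  admissible_withDensity_leb _ (isFiniteMeasure_neumannConv ht u)

lemma neumannConv_Ioc (hu : Admissible u) (ht : 0 < t) :
    Barrier.neumannConv t u (Set.Ioc 0 1) = F 0 u := by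
  have := hu.finite
  rw [← F_zero_neumannConv ht hu.ae_mem]
  exact withDensity_leb_Ioc _

lemma cuttable_neumannConv (hu : Admissible u) (ht : 0 < t)
    (h : ENNReal.ofReal (j * δ) < F 0 u) : Cuttable j δ (Barrier.neumannConv t u) where
  toAdmissible := hu.neumannConv ht
  lt_measure_Ioc := by rwa [hu.neumannConv_Ioc ht]

end Admissible

lemma admissible_densityMeasure {ρ : ℝ → ℝ} (hρ : IsBddDensity ρ) :
    Admissible (densityMeasure ρ) := by
  have : IsFiniteMeasure leb := by unfold leb; infer_instance
  exact admissible_withDensity_leb _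
    (isFiniteMeasure_withDensity_ofReal (hρ.1.integrable le_top).2)

lemma admissible_of_mem_U (hu : u ∈ U) : Admissible u := by
  obtain ⟨c, ρ, -, hρ, rfl⟩ := hu
  exact (admissible_smul_dirac_zero c).add (admissible_densityMeasure hρ)

lemma cuttable_densityMeasure {ρ : ℝ → ℝ} (hρ : IsBddDensity ρ)
    (h : ENNReal.ofReal (j * δ) < F 0 (densityMeasure ρ)) : Cuttable j δ (densityMeasure ρ) :=
  ⟨admissible_densityMeasure hρ, h.trans_eq (withDensity_leb_Ioc _).symm⟩

lemma cuttable_of_mem_UDelta (hu : u ∈ UDelta j δ) : Cuttable j δ u := by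
  obtain ⟨c, ρ, hc, hρ, rfl, hlt⟩ := hu
  exact ⟨admissible_of_mem_U ⟨c, ρ, hc, hρ, rfl⟩,
    (cuttable_densityMeasure hρ hlt).lt_measure_Ioc.trans_le le_add_self⟩

end Cut

/-! ### Comparison of barriers -/

lemma Admissible.ext_of_F {u v : Measure ℝ} (hu : Admissible u) (hv : Admissible v)
    (h : ∀ r, 0 ≤ r → F r u = F r v) : u = v := by
  have := hu.finite
  have hIci {w : Measure ℝ} (hw : Admissible w) (a : ℝ) : w (Set.Ici a) = F (max a 0) w := by
    rw [← Measure.measure_inter_eq_of_ae hw.ae_mem, ← Set.Ici_inter_Iic, Set.inter_right_comm,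
      Set.Ici_inter_Ici, Set.Ici_inter_Iic, max_comm, F]
  exact Measure.ext_of_Ici _ _ fun a => by
    rw [hIci hu, hIci hv, h _ (le_max_right a 0)]

lemma MassLE.refl (u : Measure ℝ) : MassLE u u := fun _ _ => le_rfl

lemma MassLE.trans {u v w : Measure ℝ} (huv : MassLE u v) (hvw : MassLE v w) : MassLE u w :=
  fun r hr => (huv r hr).trans (hvw r hr)

lemma MassLE.F_zero_le {u v : Measure ℝ} (huv : MassLE u v) : F 0 u ≤ F 0 v :=
  huv 0 (Set.left_mem_Icc.2 zero_le_one)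

section Barriers

variable {u v : Measure ℝ} {j s t δ : ℝ}

lemma Cuttable.of_massLE (hu : Cuttable j δ u) (hv : Admissible v) (huv : MassLE u v) :
    Cuttable j δ v :=
  ⟨hv, hu.lt_measure_Ioc.trans_le <| measure_upperSet_le_of_massLE huv Set.Ioc_subset_Icc_self
    fun _ hx _ hy => ⟨hx.1.trans_le hy.1, hy.2⟩⟩

theorem MassLE.K (hu : Cuttable j δ u) (hv : Admissible v) (huv : MassLE u v) :
    MassLE (K j δ u) (K j δ v) := fun r hr => by
  have hv' := hu.of_massLE hv huv
  rcases hr.1.eq_or_lt with rfl | h0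
  · simpa only [hu.F_zero_K, hv'.F_zero_K] using huv.F_zero_le
  · rw [hu.F_K h0, hv'.F_K h0]
    exact tsub_le_tsub_right (huv r hr) _

theorem K_neumannConv_le (ht : 0 < t) (hu : Cuttable j δ u) :
    MassLE (K j δ (neumannConv t u)) (neumannConv t (K j δ u)) := fun r hr => by
  have hKu := hu.toAdmissible.K j δ
  have := hu.finite
  have := hKu.finite
  have hGu := hu.cuttable_neumannConv ht hu.lt_F_zero
  rcases hr.1.eq_or_lt with rfl | h0
  · rw [hGu.F_zero_K, F_zero_neumannConv ht hu.ae_mem, F_zero_neumannConv ht hKu.ae_mem,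
      hu.F_zero_K]
  · rw [hGu.F_K h0, tsub_le_iff_right]
    exact F_neumannConv_le_add ht hu.ae_mem (fun s hs => hu.F_le_F_K_add hs.1) hr

section Semigroup

lemma ofReal_mul_add (hj : 0 ≤ j) (hs : 0 ≤ s) (hδ : 0 ≤ δ) :
    ENNReal.ofReal (j * (s + δ)) = ENNReal.ofReal (j * s) + ENNReal.ofReal (j * δ) := by
  rw [mul_add, ENNReal.ofReal_add (by positivity) (by positivity)]

lemma Cuttable.mono (hj : 0 ≤ j) (hsδ : s ≤ δ) (hu : Cuttable j δ u) : Cuttable j s u :=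
  ⟨hu.toAdmissible, lt_of_le_of_lt (by gcongr) hu.lt_measure_Ioc⟩

lemma Cuttable.K (hj : 0 ≤ j) (hs : 0 ≤ s) (hδ : 0 ≤ δ) (hu : Cuttable j (s + δ) u) :
    Cuttable j δ (K j s u) where
  toAdmissible := hu.toAdmissible.K j s
  lt_measure_Ioc := by
    rw [(hu.mono hj (le_add_of_nonneg_right hδ)).K_Ioc, lt_tsub_iff_left,
      ← ofReal_mul_add hj hs hδ]
    exact hu.lt_measure_Ioc

theorem K_K (hj : 0 ≤ j) (hs : 0 ≤ s) (hδ : 0 ≤ δ) (hu : Cuttable j (s + δ) u) :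
    K j δ (K j s u) = K j (s + δ) u := by
  have hus : Cuttable j s u := hu.mono hj (le_add_of_nonneg_right hδ)
  have hK := hu.K hj hs hδ
  refine (hK.toAdmissible.K j δ).ext_of_F (hu.toAdmissible.K j _) fun r hr => ?_
  rcases hr.eq_or_lt with rfl | h0
  · rw [hK.F_zero_K, hus.F_zero_K, hu.F_zero_K]
  · rw [hK.F_K h0, hus.F_K h0, hu.F_K h0, ofReal_mul_add hj hs hδ, tsub_tsub]

theorem K_neumannConv_add_le (hj : 0 ≤ j) (hs : 0 < s) (hδ : 0 < δ) (hu : Admissible u)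
    (h : ENNReal.ofReal (j * (s + δ)) < F 0 u) :
    MassLE (K j (s + δ) (neumannConv (s + δ) u))
      (K j δ (neumannConv δ (K j s (neumannConv s u)))) := by
  have := hu.finite
  have hGs := hu.cuttable_neumannConv (j := j) hs h
  have hGG := hu.cuttable_neumannConv (j := j) (add_pos hs hδ) h
  have hGs' : Cuttable j s (neumannConv s u) := hGs.mono hj (le_add_of_nonneg_right hδ.le)
  rw [← K_K hj hs.le hδ.le hGG]
  refine MassLE.K (hGG.K hj hs.le hδ.le) ((hGs.toAdmissible.K j s).neumannConv hδ) ?_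
  rw [← neumannConv_neumannConv hδ hs]
  exact K_neumannConv_le hδ hGs'

theorem neumannConv_K_le_add (hj : 0 ≤ j) (hs : 0 < s) (hδ : 0 < δ)
    (hu : Cuttable j (s + δ) u) :
    MassLE (neumannConv δ (K j δ (neumannConv s (K j s u))))
      (neumannConv (s + δ) (K j (s + δ) u)) := by
  have hKs := hu.K hj hs.le hδ.le
  have hKK := hKs.toAdmissible.K j δ
  have := hKK.finite
  have hKG := (hKs.toAdmissible.neumannConv hs).K j δ
  have := hKG.finite
  have := (hKK.neumannConv hs).finite
  rw [← K_K hj hs.le hδ.le hu, ← neumannConv_neumannConv hδ hs]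
  exact (K_neumannConv_le hs hKs).neumannConv hδ hKG.ae_mem

end Semigroup

section Iteration

protected lemma Admissible.lowerBarrier (hu : Admissible u) (hδ : 0 < δ) (n : ℕ) :
    Admissible (lowerBarrier j δ n u) := by
  induction n with
  | zero => exact hu
  | succ n ih => exact (ih.neumannConv hδ).K j δ

lemma F_zero_lowerBarrier (hu : Admissible u) (hδ : 0 < δ)
    (h : ENNReal.ofReal (j * δ) < F 0 u) (n : ℕ) : F 0 (lowerBarrier j δ n u) = F 0 u := by
  induction n with
  | zero => rfl
  | succ n ih =>
    have hn : Admissible (lowerBarrier j δ n u) := hu.lowerBarrier hδ n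
    have := hn.finite
    rw [lowerBarrier, (hn.cuttable_neumannConv hδ (by rwa [ih])).F_zero_K,
      F_zero_neumannConv hδ hn.ae_mem, ih]

protected lemma Cuttable.upperBarrier (hu : Cuttable j δ u) (hδ : 0 < δ) (n : ℕ) :
    Cuttable j δ (upperBarrier j δ n u) := by
  induction n with
  | zero => exact hu
  | succ n ih =>
    exact (ih.toAdmissible.K j δ).cuttable_neumannConv hδ (ih.F_zero_K ▸ ih.lt_F_zero)

lemma MassLE.K_neumannConv (hδ : 0 < δ) (hu : Admissible u) (hv : Admissible v)
    (h : ENNReal.ofReal (j * δ) < F 0 u) (huv : MassLE u v) :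
    MassLE (Barrier.K j δ (Barrier.neumannConv δ u))
      (Barrier.K j δ (Barrier.neumannConv δ v)) := by
  have := hu.finite
  have := hv.finite
  exact (huv.neumannConv hδ hu.ae_mem).K (hu.cuttable_neumannConv hδ h) (hv.neumannConv hδ)

theorem MassLE.lowerBarrier (hδ : 0 < δ) (hu : Admissible u) (hv : Admissible v)
    (h : ENNReal.ofReal (j * δ) < F 0 u) (huv : MassLE u v) (n : ℕ) :
    MassLE (lowerBarrier j δ n u) (lowerBarrier j δ n v) := by
  induction n with
  | zero => exact huv
  | succ n ih =>
    exact ih.K_neumannConv hδ (hu.lowerBarrier hδ n) (hv.lowerBarrier hδ n)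
      (by rwa [F_zero_lowerBarrier hu hδ h])

theorem MassLE.upperBarrier (hδ : 0 < δ) (hu : Cuttable j δ u) (hv : Admissible v)
    (huv : MassLE u v) (n : ℕ) : MassLE (upperBarrier j δ n u) (upperBarrier j δ n v) := by
  induction n with
  | zero => exact huv
  | succ n ih =>
    have hun := hu.upperBarrier hδ n
    have hvn := (hu.of_massLE hv huv).upperBarrier hδ n
    have hKu := hun.toAdmissible.K j δ
    have := hKu.finite
    have := (hvn.toAdmissible.K j δ).finite
    exact (ih.K hun hvn.toAdmissible).neumannConv hδ hKu.ae_mem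

theorem lowerBarrier_le_upperBarrier (hδ : 0 < δ) (hu : Cuttable j δ u) (n : ℕ) :
    MassLE (lowerBarrier j δ n u) (upperBarrier j δ n u) := by
  induction n with
  | zero => exact MassLE.refl u
  | succ n ih =>
    have hn := hu.upperBarrier hδ n
    refine MassLE.trans ?_ (K_neumannConv_le hδ hn)
    exact ih.K_neumannConv hδ (hu.toAdmissible.lowerBarrier hδ n) hn.toAdmissible
      (by rw [F_zero_lowerBarrier hu.toAdmissible hδ hu.lt_F_zero]; exact hu.lt_F_zero)

lemma lowerBarrier_add (j δ : ℝ) (n p : ℕ) (u : Measure ℝ) :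
    lowerBarrier j δ (n + p) u = lowerBarrier j δ p (lowerBarrier j δ n u) := by
  induction p with
  | zero => rfl
  | succ p ih => rw [← add_assoc, lowerBarrier, lowerBarrier, ih]

lemma upperBarrier_add (j δ : ℝ) (n p : ℕ) (u : Measure ℝ) :
    upperBarrier j δ (n + p) u = upperBarrier j δ p (upperBarrier j δ n u) := by
  induction p with
  | zero => rfl
  | succ p ih => rw [← add_assoc, upperBarrier, upperBarrier, ih]

end Iteration

section Refinement

variable {k : ℕ}

lemma ofReal_mul_le_ofReal_mul_natCast_mul (hj : 0 ≤ j) (hδ : 0 ≤ δ) (hk : 1 ≤ k) :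
    ENNReal.ofReal (j * δ) ≤ ENNReal.ofReal (j * (k * δ)) := by
  gcongr
  exact le_mul_of_one_le_left hδ (by exact_mod_cast hk)

lemma K_neumannConv_le_lowerBarrier (hj : 0 ≤ j) (hδ : 0 < δ) (hu : Admissible u) (hk : 1 ≤ k)
    (h : ENNReal.ofReal (j * (k * δ)) < F 0 u) :
    MassLE (K j (k * δ) (neumannConv (k * δ) u)) (lowerBarrier j δ k u) := by
  induction k, hk using Nat.le_induction with
  | base => simpa [lowerBarrier] using MassLE.refl _
  | succ k hk ih =>
    have hkδ : 0 < k * δ := by positivity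
    rw [Nat.cast_succ, add_one_mul] at h ⊢
    have hδF : ENNReal.ofReal (j * δ) < F 0 u :=
      lt_of_le_of_lt (by gcongr; exact le_add_of_nonneg_left hkδ.le) h
    have hkF : ENNReal.ofReal (j * (k * δ)) < F 0 u :=
      lt_of_le_of_lt (by gcongr; exact le_add_of_nonneg_right hδ.le) h
    have hstep := hu.cuttable_neumannConv hkδ hkF
    refine (K_neumannConv_add_le hj hkδ hδ hu h).trans ?_
    have := hu.finite
    exact (ih hkF).K_neumannConv hδ (hstep.toAdmissible.K j _) (hu.lowerBarrier hδ k)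
      (by rwa [hstep.F_zero_K, F_zero_neumannConv hkδ hu.ae_mem])

lemma upperBarrier_le_neumannConv_K (hj : 0 ≤ j) (hδ : 0 < δ) (hk : 1 ≤ k)
    (hu : Cuttable j (k * δ) u) :
    MassLE (upperBarrier j δ k u) (neumannConv (k * δ) (K j (k * δ) u)) := by
  induction k, hk using Nat.le_induction with
  | base => simpa [upperBarrier] using MassLE.refl _
  | succ k hk ih =>
    have hkδ : 0 < k * δ := by positivity
    rw [Nat.cast_succ, add_one_mul] at hu ⊢
    have huk : Cuttable j (k * δ) u := hu.mono hj (le_add_of_nonneg_right hδ.le)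
    have huδ : Cuttable j δ u := hu.mono hj (le_add_of_nonneg_left hkδ.le)
    refine MassLE.trans ?_ (neumannConv_K_le_add hj hkδ hδ hu)
    have hstep := (huk.toAdmissible.K j (k * δ)).neumannConv hkδ
    exact (ih huk).upperBarrier hδ (huδ.upperBarrier hδ k) hstep 1

theorem lowerBarrier_le_lowerBarrier_mul (hj : 0 ≤ j) (hδ : 0 < δ) (hu : Admissible u)
    (hk : 1 ≤ k) (h : ENNReal.ofReal (j * (k * δ)) < F 0 u) (m : ℕ) :
    MassLE (lowerBarrier j (k * δ) m u) (lowerBarrier j δ (m * k) u) := by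
  have hkδ : 0 < k * δ := by positivity
  induction m with
  | zero => simpa [lowerBarrier] using MassLE.refl u
  | succ m ih =>
    have hfine : Admissible (lowerBarrier j δ (m * k) u) := hu.lowerBarrier hδ _
    have hFfine := F_zero_lowerBarrier hu hδ
      ((ofReal_mul_le_ofReal_mul_natCast_mul hj hδ.le hk).trans_lt h) (m * k)
    rw [Nat.succ_mul, lowerBarrier_add j δ]
    exact (ih.K_neumannConv hkδ (hu.lowerBarrier hkδ m) hfine
      (by rwa [F_zero_lowerBarrier hu hkδ h])).trans
      (K_neumannConv_le_lowerBarrier hj hδ hfine hk (by rwa [hFfine]))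

theorem upperBarrier_mul_le_upperBarrier (hj : 0 ≤ j) (hδ : 0 < δ) (hk : 1 ≤ k)
    (hu : Cuttable j (k * δ) u) (m : ℕ) :
    MassLE (upperBarrier j δ (m * k) u) (upperBarrier j (k * δ) m u) := by
  have hkδ : 0 < k * δ := by positivity
  have huδ : Cuttable j δ u :=
    hu.mono hj (le_mul_of_one_le_left hδ.le (by exact_mod_cast hk))
  induction m with
  | zero => simpa [upperBarrier] using MassLE.refl u
  | succ m ih =>
    have hcoarse := hu.upperBarrier hkδ m
    rw [Nat.succ_mul, upperBarrier_add j δ]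
    exact (ih.upperBarrier hδ (huδ.upperBarrier hδ _) hcoarse.toAdmissible k).trans
      (upperBarrier_le_neumannConv_K hj hδ hk hcoarse)

end Refinement

end Barriers

end Barrier

open Barrier in
theorem theorem6p3_general {j : ℝ} (hj : 0 ≤ j) :
    (∀ (u : Measure ℝ) (δ δ' : ℝ), 0 < δ → Cuttable j δ u →
      ∀ k : ℕ, 0 < k → δ = k * δ' → ∀ m : ℕ,
        MassLE (lowerBarrier j δ m u) (lowerBarrier j δ' (m * k) u) ∧
        MassLE (lowerBarrier j δ' (m * k) u) (upperBarrier j δ' (m * k) u) ∧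
        MassLE (upperBarrier j δ' (m * k) u) (upperBarrier j δ m u)) ∧
    (∀ δ : ℝ, 0 < δ → ∀ u v : Measure ℝ, Cuttable j δ u → Admissible v → MassLE u v →
      MassLE (K j δ u) (K j δ v)) ∧
    (∀ t : ℝ, 0 < t → ∀ u v : Measure ℝ, SFinite u → SFinite v →
      (∀ᵐ x ∂u, x ∈ Set.Icc (0 : ℝ) 1) → MassLE u v →
      MassLE (neumannConv t u) (neumannConv t v)) ∧
    (∀ δ : ℝ, 0 < δ → ∀ u v : Measure ℝ, Cuttable j δ u → Admissible v → MassLE u v →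
      ∀ n : ℕ, MassLE (lowerBarrier j δ n u) (lowerBarrier j δ n v) ∧
        MassLE (upperBarrier j δ n u) (upperBarrier j δ n v)) := by
  refine ⟨?_, fun _ _ _ _ hu hv huv => huv.K hu hv,
    fun _ ht _ _ _ _ hu huv => huv.neumannConv ht hu, fun _ hδ _ _ hu hv huv n =>
      ⟨huv.lowerBarrier hδ hu.toAdmissible hv hu.lt_F_zero n, huv.upperBarrier hδ hu hv n⟩⟩
  rintro u _ δ' hδ hu k hk rfl m
  have hδ' : 0 < δ' := pos_of_mul_pos_right hδ k.cast_nonneg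
  exact ⟨lowerBarrier_le_lowerBarrier_mul hj hδ' hu.toAdmissible hk hu.lt_F_zero m,
    lowerBarrier_le_upperBarrier hδ'
      (hu.mono hj (le_mul_of_one_le_left hδ'.le (by exact_mod_cast hk))) _,
    upperBarrier_mul_le_upperBarrier hj hδ' hk hu m⟩

/-- Macroscopic inequalities between barriers. Since `δ = k δ'`, the time `m δ` is `m` steps of
length `δ` and `m * k` steps of length `δ'`. -/
theorem theorem6p3 (j : ℝ) (hj : 0 < j) :
    (∀ ρ : ℝ → ℝ, Barrier.IsBddDensity ρ →
      0 < Barrier.F 0 (Barrier.densityMeasure ρ) →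
      ∀ δ δ' : ℝ, 0 < δ →
        ENNReal.ofReal (j * δ) < Barrier.F 0 (Barrier.densityMeasure ρ) →
        ∀ k : ℕ, 0 < k → δ = k * δ' → ∀ m : ℕ,
          Barrier.MassLE (Barrier.lowerBarrier j δ m (Barrier.densityMeasure ρ))
            (Barrier.lowerBarrier j δ' (m * k) (Barrier.densityMeasure ρ)) ∧
          Barrier.MassLE (Barrier.lowerBarrier j δ' (m * k) (Barrier.densityMeasure ρ))
            (Barrier.upperBarrier j δ' (m * k) (Barrier.densityMeasure ρ)) ∧
          Barrier.MassLE (Barrier.upperBarrier j δ' (m * k) (Barrier.densityMeasure ρ))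
            (Barrier.upperBarrier j δ m (Barrier.densityMeasure ρ))) ∧
    (∀ δ : ℝ, 0 < δ → ∀ u ∈ Barrier.UDelta j δ, ∀ v ∈ Barrier.UDelta j δ,
      Barrier.MassLE u v → Barrier.MassLE (Barrier.K j δ u) (Barrier.K j δ v)) ∧
    (∀ t : ℝ, 0 < t → ∀ u ∈ Barrier.U, ∀ v ∈ Barrier.U,
      Barrier.MassLE u v → Barrier.MassLE (Barrier.neumannConv t u) (Barrier.neumannConv t v)) ∧
    (∀ δ : ℝ, 0 < δ → ∀ u ∈ Barrier.UDelta j δ, ∀ v ∈ Barrier.UDelta j δ,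
      Barrier.MassLE u v → ∀ n : ℕ,
        Barrier.MassLE (Barrier.lowerBarrier j δ n u) (Barrier.lowerBarrier j δ n v) ∧
        Barrier.MassLE (Barrier.upperBarrier j δ n u) (Barrier.upperBarrier j δ n v)) := by
  obtain ⟨hrefine, hK, hG, hS⟩ := theorem6p3_general hj.le
  exact ⟨fun ρ hρ _ δ δ' hδ hlt =>
      hrefine _ δ δ' hδ (Barrier.cuttable_densityMeasure hρ hlt),
    fun δ hδ u hu v hv => hK δ hδ u v (Barrier.cuttable_of_mem_UDelta hu)
      (Barrier.cuttable_of_mem_UDelta hv).toAdmissible,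
    fun t ht u hu v hv => hG t ht u v (Barrier.admissible_of_mem_U hu).sFinite
      (Barrier.admissible_of_mem_U hv).sFinite (Barrier.admissible_of_mem_U hu).ae_mem,
    fun δ hδ u hu v hv => hS δ hδ u v (Barrier.cuttable_of_mem_UDelta hu)
      (Barrier.cuttable_of_mem_UDelta hv).toAdmissible⟩
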